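/- Identify a partition with its Young diagram, and let Par be the set of all partitions (the empty partition $\emptyset$ included). For $\alpha,\beta,\mu\in \mathrm{Par}$ the Littlewood–Richardson coefficient $c_{\alpha,\beta}^{\mu}$ is the number of semistandard fillings of the skew shape $\mu/\alpha$ by positive integers (rows weakly increasing from left to right, columns strictly increasing from top to bottom) that have content $\beta$ and whose reading word (rows from top to bottom, each row from right to left) is ballot, i.e. in every initial segment of the word and for every $i\ge 1$, the letter $i$ occurs at least as often as the letter $i+1$; one sets $c_{\alpha,\beta}^{\mu}=0$ if $\alpha\not\subseteq\mu$. For $\mu,\nu,\lambda\in\mathrm{Par}$ the Newell–Littlewood number is $$N_{\mu,\nu,\lambda}=\sum_{\alpha,\beta,\gamma\in\mathrm{Par}} c_{\alpha,\beta}^{\mu}\,c_{\alpha,\gamma}^{\nu}\,c_{\beta,\gamma}^{\lambda},$$ a sum with finitely many nonzero terms. A pair $(\mu,\nu)\in\mathrm{Par}^2$ is called NL-multiplicity-free if $N_{\mu,\nu,\lambda}\in\{0,1\}$ for all $\lambda\in\mathrm{Par}$. **Theorem.** A pair $(\mu,\nu)\in\mathrm{Par}^2$ is NL-multiplicity-free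 if and only if at least one of the following holds: (I) $\mu$ or $\nu$ is either a single box or $\emptyset$; (II) $\mu$ is a single row and $\nu$ is a rectangle, or vice versa; (III) $\mu$ is a single column and $\nu$ is a rectangle, or vice versa. Here a rectangle is a partition $(c^r)$ with $r,c\ge 1$; it is a single row if $r=1$ and a single column if $c=1$. -/

import Mathlib

namespace NewellLittlewood

/-- The cells of the skew shape `lam / mu`. Cells are pairs (row, column), both counted from `0`,
rows going down and columns going right. -/
def skewCells (mu lam : YoungDiagram) : Finset (ℕ × ℕ) :=
  lam.cells \ mu.cells

/-- The cells of `lam / mu` that are read no later than the cell `c` by the row reading word, which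
reads the rows from top to bottom and each row from right to left. -/
def readUpTo (mu lam : YoungDiagram) (c : ℕ × ℕ) : Finset (ℕ × ℕ) :=
  (skewCells mu lam).filter fun d => d.1 < c.1 ∨ (d.1 = c.1 ∧ c.2 ≤ d.2)

/-- A Littlewood-Richardson tableau: a ballot, semistandard filling of the skew shape `lam / mu`
by positive integers, with content `nu`. The filling is extended by zero outside the skew shape,
so that two tableaux are equal exactly when their fillings of the shape are. -/
@[ext]
structure LRTableau (mu nu lam : YoungDiagram) where
  /-- The entry in row `i` and column `j`. -/
  entry : ℕ → ℕ → ℕ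
  /-- `lam / mu` is a skew shape. -/
  le : mu ≤ lam
  /-- Entries of the shape are positive. -/
  pos : ∀ i j, (i, j) ∈ skewCells mu lam → 1 ≤ entry i j
  /-- There are no entries outside the shape. -/
  zeros : ∀ i j, (i, j) ∉ skewCells mu lam → entry i j = 0
  /-- Rows weakly increase from left to right. -/
  row_weak : ∀ i j₁ j₂, j₁ < j₂ → (i, j₁) ∈ skewCells mu lam → (i, j₂) ∈ skewCells mu lam →
    entry i j₁ ≤ entry i j₂
  /-- Columns strictly increase from top to bottom. -/
  col_strict : ∀ i₁ i₂ j, i₁ < i₂ → (i₁, j) ∈ skewCells mu lam → (i₂, j) ∈ skewCells mu lam →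
    entry i₁ j < entry i₂ j
  /-- The content is `nu`: the number of entries `k + 1` is the length of row `k` of `nu`
  (rows of `nu` are counted from `0`). -/
  content : ∀ k, ((skewCells mu lam).filter fun c => entry c.1 c.2 = k + 1).card = nu.rowLen k
  /-- The reading word is ballot: in each nonempty initial segment of it (given by its last cell
  `c`), each `k ≥ 1` occurs at least as often as `k + 1`. -/
  ballot : ∀ c ∈ skewCells mu lam, ∀ k, 1 ≤ k →
    ((readUpTo mu lam c).filter fun d => entry d.1 d.2 = k + 1).card ≤
      ((readUpTo mu lam c).filter fun d => entry d.1 d.2 = k).card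

/-- The Littlewood-Richardson coefficient `c_{mu,nu}^{lam}`: the number of Littlewood-Richardson
tableaux of shape `lam / mu` and content `nu`. There are finitely many, see
`NewellLittlewood.finite_LRTableau`. -/
noncomputable def lrCoeff (mu nu lam : YoungDiagram) : ℕ :=
  Nat.card (LRTableau mu nu lam)

/-- The Newell-Littlewood number `N_{mu,nu,lam}`, the sum over all partitions `a`, `b`, `g` of
`c_{a,b}^{mu} c_{a,g}^{nu} c_{b,g}^{lam}`. Only finitely many summands are nonzero, see
`NewellLittlewood.finite_support`. -/
noncomputable def nlNumber (mu nu lam : YoungDiagram) : ℕ :=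
  ∑ᶠ t : YoungDiagram × YoungDiagram × YoungDiagram,
    lrCoeff t.1 t.2.1 mu * lrCoeff t.1 t.2.2 nu * lrCoeff t.2.1 t.2.2 lam

/-- The pair `(mu, nu)` is NL-multiplicity-free. -/
def IsNLMultiplicityFree (mu nu : YoungDiagram) : Prop :=
  ∀ lam : YoungDiagram, nlNumber mu nu lam = 0 ∨ nlNumber mu nu lam = 1

/-- The diagram is a rectangle with `r ≥ 1` rows and `c ≥ 1` columns. -/
def IsRectangle (mu : YoungDiagram) : Prop :=
  ∃ r c : ℕ, 1 ≤ r ∧ 1 ≤ c ∧ mu.cells = Finset.range r ×ˢ Finset.range c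

/-- The diagram is a single (nonempty) row. -/
def IsSingleRow (mu : YoungDiagram) : Prop :=
  ∃ c : ℕ, 1 ≤ c ∧ mu.cells = {0} ×ˢ Finset.range c

/-- The diagram is a single (nonempty) column. -/
def IsSingleColumn (mu : YoungDiagram) : Prop :=
  ∃ r : ℕ, 1 ≤ r ∧ mu.cells = Finset.range r ×ˢ {0}

/-- The diagram is a single box. -/
def IsSingleBox (mu : YoungDiagram) : Prop :=
  mu.cells = {(0, 0)}

theorem entry_le {mu nu lam : YoungDiagram} (T : LRTableau mu nu lam) (i j : ℕ) :
    T.entry i j ≤ nu.colLen 0 := by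
  by_cases h : (i, j) ∈ skewCells mu lam
  · obtain ⟨k, hk⟩ : ∃ k, T.entry i j = k + 1 := ⟨T.entry i j - 1, by have := T.pos i j h; omega⟩
    have h1 : 0 < nu.rowLen k := by
      rw [← T.content k]
      exact Finset.card_pos.mpr ⟨(i, j), by simp [h, hk]⟩
    rw [← YoungDiagram.mem_iff_lt_rowLen, YoungDiagram.mem_iff_lt_colLen] at h1
    omega
  · rw [T.zeros i j h]
    exact Nat.zero_le _

/-- There are finitely many Littlewood-Richardson tableaux of given shape and content. -/
instance finite_LRTableau (mu nu lam : YoungDiagram) : Finite (LRTableau mu nu lam) := by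
  let f : LRTableau mu nu lam → (skewCells mu lam → Fin (nu.colLen 0 + 1)) :=
    fun T c => ⟨T.entry c.1.1 c.1.2, Nat.lt_succ_of_le (entry_le T _ _)⟩
  refine Finite.of_injective f fun T S h => ?_
  ext i j
  by_cases hc : (i, j) ∈ skewCells mu lam
  · simpa [f] using congrFun h ⟨(i, j), hc⟩
  · rw [T.zeros i j hc, S.zeros i j hc]

theorem nonempty_of_lrCoeff_ne_zero {mu nu lam : YoungDiagram} (h : lrCoeff mu nu lam ≠ 0) :
    Nonempty (LRTableau mu nu lam) :=
  (Nat.card_ne_zero.mp h).1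

/-- A nonzero coefficient bounds the content diagram by a square. -/
theorem cells_subset_of_lrCoeff_ne_zero {mu nu lam : YoungDiagram} (h : lrCoeff mu nu lam ≠ 0) :
    nu.cells ⊆ Finset.range lam.card ×ˢ Finset.range lam.card := by
  obtain ⟨T⟩ := nonempty_of_lrCoeff_ne_zero h
  have hs : (skewCells mu lam).card ≤ lam.card := Finset.card_le_card Finset.sdiff_subset
  have hrow : ∀ k, nu.rowLen k ≤ lam.card := fun k => by
    rw [← T.content k]
    exact (Finset.card_filter_le _ _).trans hs
  have hcol : nu.colLen 0 ≤ lam.card := by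
    have hsub : Finset.range (nu.colLen 0) ⊆
        (skewCells mu lam).image fun c => T.entry c.1 c.2 - 1 := by
      intro k hk
      rw [Finset.mem_range, ← YoungDiagram.mem_iff_lt_colLen, YoungDiagram.mem_iff_lt_rowLen,
        ← T.content k, Finset.card_pos] at hk
      obtain ⟨c, hc⟩ := hk
      rw [Finset.mem_filter] at hc
      exact Finset.mem_image.mpr ⟨c, hc.1, by simp [hc.2]⟩
    have := Finset.card_le_card hsub
    rw [Finset.card_range] at this
    exact this.trans (Finset.card_image_le.trans hs)
  rintro ⟨i, j⟩ hc
  rw [YoungDiagram.mem_cells] at hc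
  rw [Finset.mem_product, Finset.mem_range, Finset.mem_range]
  exact ⟨((YoungDiagram.mem_iff_lt_colLen.mp hc).trans_le (nu.colLen_anti 0 j (Nat.zero_le _))).trans_le
      hcol, (YoungDiagram.mem_iff_lt_rowLen.mp hc).trans_le (hrow i)⟩

theorem finite_setOf_cells_subset (s : Finset (ℕ × ℕ)) :
    {mu : YoungDiagram | mu.cells ⊆ s}.Finite := by
  refine Set.Finite.of_finite_image (f := YoungDiagram.cells)
    (s.powerset.finite_toSet.subset ?_) fun _ _ _ _ h => YoungDiagram.ext h
  rintro _ ⟨mu, hmu, rfl⟩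
  simpa using hmu

/-- The sum that defines the Newell-Littlewood number has finitely many nonzero summands. -/
theorem finite_support (mu nu lam : YoungDiagram) :
    (Function.support fun t : YoungDiagram × YoungDiagram × YoungDiagram =>
      lrCoeff t.1 t.2.1 mu * lrCoeff t.1 t.2.2 nu * lrCoeff t.2.1 t.2.2 lam).Finite := by
  refine ((finite_setOf_cells_subset mu.cells).prod
    ((finite_setOf_cells_subset (Finset.range mu.card ×ˢ Finset.range mu.card)).prod
      (finite_setOf_cells_subset (Finset.range nu.card ×ˢ Finset.range nu.card)))).subset ?_
  rintro ⟨a, b, g⟩ h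
  have h' : (lrCoeff a b mu ≠ 0 ∧ lrCoeff a g nu ≠ 0) ∧ lrCoeff b g lam ≠ 0 := by
    simpa [mul_ne_zero_iff] using h
  obtain ⟨T⟩ := nonempty_of_lrCoeff_ne_zero h'.1.1
  exact ⟨T.le, cells_subset_of_lrCoeff_ne_zero h'.1.1, cells_subset_of_lrCoeff_ne_zero h'.1.2⟩

end NewellLittlewood

open NewellLittlewood

namespace NewellLittlewood

open Finset

/-! ### Tableaux as integer patterns: linear inequalities in place of fillings -/

section

/-! An LR tableau is recorded by the numbers `G` and `C`, for which semistandardness and the ballot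
condition become linear equations and inequalities. Patterns can therefore be added, and shapes,
contents and outer shapes add along with them.

Sufficiency. A nonzero term gives |α|+|β|=|μ|, |α|+|γ|=|ν| and |β|+|γ|=|λ|, so the three sizes are
determined. If μ is a row or a column, its subdiagrams form a chain and are determined by their
size, hence so are α and β. If ν is a rectangle, γ is the rotated complement of α in ν; if |μ| ≤ 1,
then α or β is empty and γ is ν or λ. So at most one triple contributes, and its coefficients are at
most 1 because each has a thin inner shape or content (`LRPattern.G_eq_of_thin_inner`,
`LRPattern.G_eq_of_thin_content`). The same argument works with μ and ν exchanged.

Necessity. Always take α to be a box, and suppose that neither partition is empty or a box. If one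
of them is not a rectangle, it has two corners; removing either one gives two different triples with
a common λ. If both are rectangles with at least two rows and two columns, removing the corner from
each gives β and γ with c_{β,γ}^λ ≥ 2 for some λ, which generalizes c_{21,21}^{321} = 2. Since
patterns add, it is enough to exhibit them for the few columns involved (`LRPattern.columnMulShort`,
`LRPattern.twoColumns₁` and their companions); all other columns are added by `LRPattern.empty` and
`LRPattern.straight`. -/

/-- A Littlewood-Richardson tableau of inner shape `b`, content `c` and outer shape `l`, given by
the number `G i k` of cells of row `i` (cells of the inner shape included) with entry at most `k`
and the number `C i k` of entries `k + 1` above row `i`. -/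
structure LRPattern (b c l : ℕ → ℕ) where
  G : ℕ → ℕ → ℕ
  C : ℕ → ℕ → ℕ
  G_zero : ∀ i, G i 0 = b i
  G_top : ∃ K, ∀ i k, K ≤ k → G i k = l i
  G_mono : ∀ i k, G i k ≤ G i (k + 1)
  G_strip : ∀ i k, G (i + 1) (k + 1) ≤ G i k
  C_zero : ∀ k, C 0 k = 0
  C_top : ∃ I, ∀ i k, I ≤ i → C i k = c k
  step : ∀ i k, C (i + 1) k + G i k = C i k + G i (k + 1)
  C_strip : ∀ i k, C (i + 1) (k + 1) ≤ C i k

namespace LRPattern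

variable {b c l b' c' l' : ℕ → ℕ}

/-- Patterns form a semigroup. -/
def add (P : LRPattern b c l) (Q : LRPattern b' c' l') :
    LRPattern (b + b') (c + c') (l + l') where
  G i k := P.G i k + Q.G i k
  C i k := P.C i k + Q.C i k
  G_zero i := by simp [P.G_zero, Q.G_zero]
  G_top := by
    obtain ⟨K, hK⟩ := P.G_top
    obtain ⟨K', hK'⟩ := Q.G_top
    refine ⟨max K K', fun i k h => ?_⟩
    simp [hK i k (le_of_max_le_left h), hK' i k (le_of_max_le_right h)]
  G_mono i k := add_le_add (P.G_mono i k) (Q.G_mono i k)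
  G_strip i k := add_le_add (P.G_strip i k) (Q.G_strip i k)
  C_zero k := by simp [P.C_zero, Q.C_zero]
  C_top := by
    obtain ⟨K, hK⟩ := P.C_top
    obtain ⟨K', hK'⟩ := Q.C_top
    refine ⟨max K K', fun i k h => ?_⟩
    simp [hK i k (le_of_max_le_left h), hK' i k (le_of_max_le_right h)]
  step i k := by have := P.step i k; have := Q.step i k; omega
  C_strip i k := add_le_add (P.C_strip i k) (Q.C_strip i k)

variable (P : LRPattern b c l)

theorem G_monotone (i : ℕ) : Monotone (P.G i) := monotone_nat_of_le_succ (P.G_mono i)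

theorem G_le (i k : ℕ) : P.G i k ≤ l i := by
  obtain ⟨K, hK⟩ := P.G_top
  rw [← hK i (max K k) (le_max_left _ _)]
  exact P.G_monotone i (le_max_right _ _)

theorem le_G (i k : ℕ) : b i ≤ P.G i k := by
  rw [← P.G_zero]
  exact P.G_monotone i (Nat.zero_le _)

theorem C_monotone (k : ℕ) : Monotone fun i => P.C i k :=
  monotone_nat_of_le_succ fun i => by
    have := P.step i k
    have := P.G_mono i k
    omega

theorem C_le (i k : ℕ) : P.C i k ≤ c k := by
  obtain ⟨K, hK⟩ := P.C_top
  rw [← hK (max K i) k (le_max_left _ _)]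
  exact P.C_monotone k (le_max_right _ _)

/-- By the ballot condition a letter needs its predecessor in a strictly higher row, so row `i`
contains no letter above `i + 1`. -/
theorem C_eq_zero {i k : ℕ} (h : i ≤ k) : P.C i k = 0 := by
  induction i generalizing k with
  | zero => exact P.C_zero k
  | succ i ih =>
    obtain ⟨k, rfl⟩ : ∃ m, k = m + 1 := ⟨k - 1, by omega⟩
    have := P.C_strip i k
    rw [ih (by omega)] at this
    omega

theorem G_eq_top {i k : ℕ} (h : i < k) : P.G i k = l i := by
  obtain ⟨K, hK⟩ := P.G_top
  have key : ∀ n, P.G i (k + n) = P.G i k := by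
    intro n
    induction n with
    | zero => rfl
    | succ n ih =>
      have := P.step i (k + n)
      rw [P.C_eq_zero (show i + 1 ≤ k + n by omega), P.C_eq_zero (show i ≤ k + n by omega)] at this
      rw [← ih, ← add_assoc]
      omega
  rw [← key K, hK i _ (by omega)]

end LRPattern

variable {α β γ : YoungDiagram}

theorem mem_skewCells_iff {i j : ℕ} :
    (i, j) ∈ skewCells α γ ↔ α.rowLen i ≤ j ∧ j < γ.rowLen i := by
  simp only [skewCells, mem_sdiff, YoungDiagram.mem_cells, YoungDiagram.mem_iff_lt_rowLen]
  omega

theorem rowLen_le_of_le (h : α ≤ γ) (i : ℕ) : α.rowLen i ≤ γ.rowLen i := by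
  by_contra! hlt
  rw [← YoungDiagram.mem_iff_lt_rowLen] at hlt
  exact lt_irrefl _ (YoungDiagram.mem_iff_lt_rowLen.1 (h hlt))

theorem card_filter_fst_eq (s : Finset (ℕ × ℕ)) (i : ℕ) (t : Finset ℕ)
    (h : ∀ j, (i, j) ∈ s ↔ j ∈ t) : (s.filter fun c => c.1 = i).card = t.card := by
  refine card_bij (fun c _ => c.2) ?_ ?_ ?_
  · rintro ⟨x, y⟩ hc
    obtain ⟨hs, rfl⟩ := mem_filter.1 hc
    exact (h y).1 hs
  · rintro ⟨x, y⟩ hc ⟨x', y'⟩ hc' hy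
    obtain ⟨-, rfl⟩ := mem_filter.1 hc
    obtain ⟨-, hx⟩ := mem_filter.1 hc'
    exact Prod.ext hx.symm hy
  · exact fun j hj => ⟨(i, j), mem_filter.2 ⟨(h j).2 hj, rfl⟩, rfl⟩

theorem card_filter_fst_lt_succ (s : Finset (ℕ × ℕ)) (i : ℕ) :
    (s.filter fun c => c.1 < i + 1).card =
      (s.filter fun c => c.1 < i).card + (s.filter fun c => c.1 = i).card := by
  rw [← card_union_of_disjoint]
  · congr 1
    ext c
    simp only [mem_filter, mem_union]
    constructor
    · rintro ⟨h, h'⟩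
      rcases Nat.lt_succ_iff_lt_or_eq.1 h' with h'' | h''
      exacts [.inl ⟨h, h''⟩, .inr ⟨h, h''⟩]
    · rintro (⟨h, h'⟩ | ⟨h, h'⟩)
      exacts [⟨h, by omega⟩, ⟨h, by omega⟩]
  · rw [disjoint_left]
    intro c hc hc'
    simp only [mem_filter] at hc hc'
    omega

theorem fst_lt_of_mem_skewCells {c : ℕ × ℕ} (h : c ∈ skewCells α γ) : c.1 < γ.colLen 0 := by
  obtain ⟨i, j⟩ := c
  rw [mem_skewCells_iff, ← YoungDiagram.mem_iff_lt_rowLen, YoungDiagram.mem_iff_lt_colLen] at h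
  exact h.2.trans_le (γ.colLen_anti 0 j (Nat.zero_le _))

namespace LRPattern

variable (P : LRPattern α.rowLen β.rowLen γ.rowLen)

theorem exists_lt_G {i j : ℕ} (h : j < γ.rowLen i) : ∃ k, j < P.G i k :=
  ⟨i + 1, by rwa [P.G_eq_top (Nat.lt_succ_self i)]⟩

open Classical in
/-- The filling described by a pattern. -/
noncomputable def entryFn (i j : ℕ) : ℕ :=
  if h : (i, j) ∈ skewCells α γ then Nat.find (P.exists_lt_G (mem_skewCells_iff.1 h).2) else 0

theorem entryFn_le_iff {i j k : ℕ} (h : (i, j) ∈ skewCells α γ) :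
    P.entryFn i j ≤ k ↔ j < P.G i k := by
  classical
  rw [entryFn, dif_pos h, Nat.find_le_iff]
  exact ⟨fun ⟨m, hm, hj⟩ => hj.trans_le (P.G_monotone i hm), fun hj => ⟨k, le_rfl, hj⟩⟩

theorem card_entryFn_row (i k : ℕ) :
    (((skewCells α γ).filter fun c => P.entryFn c.1 c.2 = k + 1).filter fun c => c.1 = i).card =
      P.G i (k + 1) - P.G i k := by
  rw [card_filter_fst_eq _ i (Finset.Ico (P.G i k) (P.G i (k + 1))), Nat.card_Ico]
  intro j
  rw [mem_filter, Finset.mem_Ico]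
  constructor
  · rintro ⟨h, h'⟩
    have h1 := P.entryFn_le_iff (k := k) h
    have h2 := P.entryFn_le_iff (k := k + 1) h
    simp only at h'
    omega
  · rintro ⟨h, h'⟩
    have hm : (i, j) ∈ skewCells α γ :=
      mem_skewCells_iff.2 ⟨(P.le_G i k).trans h, h'.trans_le (P.G_le i _)⟩
    have h1 := P.entryFn_le_iff (k := k) hm
    have h2 := P.entryFn_le_iff (k := k + 1) hm
    exact ⟨hm, by simp only; omega⟩

theorem card_entryFn_above (i k : ℕ) :
    (((skewCells α γ).filter fun c => P.entryFn c.1 c.2 = k + 1).filter fun c => c.1 < i).card =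
      P.C i k := by
  induction i with
  | zero => simp [P.C_zero]
  | succ i ih =>
    rw [card_filter_fst_lt_succ, ih, card_entryFn_row]
    have := P.step i k
    have := P.G_mono i k
    omega

/-- The tableau described by a pattern. -/
noncomputable def toTableau : LRTableau α β γ where
  entry := P.entryFn
  le := by
    rintro ⟨i, j⟩ h
    simp only [YoungDiagram.mem_iff_lt_rowLen] at h ⊢
    exact h.trans_le ((P.le_G i 0).trans (P.G_le i 0))
  pos i j h := by
    by_contra h0
    have := (P.entryFn_le_iff (k := 0) h).1 (by omega)
    rw [P.G_zero] at this
    have := (mem_skewCells_iff.1 h).1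
    omega
  zeros i j h := by rw [entryFn, dif_neg h]
  row_weak i j₁ j₂ h h₁ h₂ := by
    rw [P.entryFn_le_iff h₁]
    exact h.trans ((P.entryFn_le_iff h₂).1 le_rfl)
  col_strict i₁ i₂ j h h₁ h₂ := by
    obtain ⟨d, rfl⟩ : ∃ d, i₂ = i₁ + (d + 1) := ⟨i₂ - i₁ - 1, by omega⟩
    -- Going up `d` rows lowers the entry by at least `d`. When `k - d` would truncate, `hb` takes
    -- over: so small an entry forces the upper cell into the inner shape.
    have hG : ∀ d k, P.G (i₁ + d) k ≤ P.G i₁ (k - d) ∨ k < d := by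
      intro d
      induction d with
      | zero => intro k; simp
      | succ d ih =>
        intro k
        rcases k with _ | k
        · right; omega
        · have h1 := P.G_strip (i₁ + d) k
          rcases ih k with h2 | h2
          · left
            rw [Nat.add_sub_add_right]
            exact h1.trans h2
          · right; omega
    have hb : ∀ d k, k ≤ d → P.G (i₁ + d) k ≤ α.rowLen i₁ := by
      intro d
      induction d with
      | zero =>
        intro k hk
        obtain rfl : k = 0 := by omega
        simp [P.G_zero]
      | succ d ih =>
        intro k hk
        rcases k with _ | k
        · rw [P.G_zero]
          exact α.rowLen_anti _ _ (by omega)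
        · exact (P.G_strip (i₁ + d) k).trans (ih k (by omega))
    have h3 := (P.entryFn_le_iff h₂).1 le_rfl
    have h4 := (mem_skewCells_iff.1 h₁).1
    by_contra hlt
    have h5 := mt (P.entryFn_le_iff (k := P.entryFn (i₁ + (d + 1)) j - (d + 1)) h₁).2
    rcases hG (d + 1) (P.entryFn (i₁ + (d + 1)) j) with h6 | h6
    · have h7 := hb (d + 1) (P.entryFn (i₁ + (d + 1)) j)
      have := h5 (by omega)
      omega
    · have := hb (d + 1) _ h6.le
      omega
  content k := by
    obtain ⟨I, hI⟩ := P.C_top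
    rw [← hI (max I (γ.colLen 0)) k (le_max_left _ _), ← card_entryFn_above, filter_filter]
    congr 1
    refine filter_congr fun c hc => ?_
    have := fst_lt_of_mem_skewCells hc
    simp [this]
  ballot c hc k hk := by
    obtain ⟨k, rfl⟩ : ∃ m, k = m + 1 := ⟨k - 1, by omega⟩
    -- The larger letter is counted through the end of the current row and the smaller one only in
    -- the rows above it; `C_strip` still holds with this margin.
    calc _ ≤ P.C (c.1 + 1) (k + 1) := by
          rw [← card_entryFn_above]
          refine card_le_card fun d hd => ?_
          simp only [readUpTo, mem_filter] at hd ⊢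
          exact ⟨⟨hd.1.1, hd.2⟩, by omega⟩
      _ ≤ P.C c.1 k := P.C_strip _ _
      _ ≤ _ := by
          rw [← card_entryFn_above]
          refine card_le_card fun d hd => ?_
          simp only [readUpTo, mem_filter] at hd ⊢
          exact ⟨⟨hd.1.1, by omega⟩, hd.1.2⟩

/-- Two different patterns give two different tableaux; this yields the lower bound 2 on a
coefficient. -/
theorem G_eq_of_toTableau_eq {P Q : LRPattern α.rowLen β.rowLen γ.rowLen}
    (h : P.toTableau = Q.toTableau) (i k : ℕ) : P.G i k = Q.G i k := by
  have key : ∀ {P Q : LRPattern α.rowLen β.rowLen γ.rowLen}, P.toTableau = Q.toTableau →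
      P.G i k ≤ Q.G i k := by
    intro P Q h
    by_contra! hlt
    have hm : (i, Q.G i k) ∈ skewCells α γ :=
      mem_skewCells_iff.2 ⟨Q.le_G i k, hlt.trans_le (P.G_le i k)⟩
    have h1 := (P.entryFn_le_iff hm).2 hlt
    have h2 : P.entryFn = Q.entryFn := congrArg LRTableau.entry h
    rw [h2, Q.entryFn_le_iff hm] at h1
    omega
  exact le_antisymm (key h) (key h.symm)

end LRPattern

namespace LRTableau

variable (T : LRTableau α β γ)

theorem entry_mono {i j₁ j₂ : ℕ} (h : j₁ ≤ j₂) (h₂ : j₂ < γ.rowLen i) :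
    T.entry i j₁ ≤ T.entry i j₂ := by
  by_cases h₁ : (i, j₁) ∈ skewCells α γ
  · rcases h.lt_or_eq with h | rfl
    · refine T.row_weak i j₁ j₂ h h₁ (mem_skewCells_iff.2 ⟨?_, h₂⟩)
      have := (mem_skewCells_iff.1 h₁).1
      omega
    · rfl
  · rw [T.zeros i j₁ h₁]
    exact Nat.zero_le _

/-- The number of cells of row `i` with entry at most `k`, cells of the inner shape included. -/
def rowCount (i k : ℕ) : ℕ := ((range (γ.rowLen i)).filter fun j => T.entry i j ≤ k).card

/-- The number of entries `k + 1` above row `i`. -/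
def countAbove (i k : ℕ) : ℕ :=
  (((skewCells α γ).filter fun c => T.entry c.1 c.2 = k + 1).filter fun c => c.1 < i).card

/-- Inner cells carry the default entry 0, so each full row of the outer shape is weakly increasing
and its sublevel sets are initial segments. -/
theorem filter_entry_le_eq_range (i k : ℕ) :
    ((range (γ.rowLen i)).filter fun j => T.entry i j ≤ k) = range (T.rowCount i k) := by
  refine Finset.eq_of_subset_of_card_le ?_ (by rw [card_range, rowCount])
  intro j hj
  rw [mem_filter, mem_range] at hj
  have hsub : range (j + 1) ⊆ (range (γ.rowLen i)).filter fun j => T.entry i j ≤ k := by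
    intro m hm
    rw [mem_range] at hm
    rw [mem_filter, mem_range]
    exact ⟨by omega, (T.entry_mono (by omega) hj.1).trans hj.2⟩
  have := card_le_card hsub
  rw [card_range] at this
  exact mem_range.2 this

theorem lt_rowCount_iff {i j k : ℕ} :
    j < T.rowCount i k ↔ j < γ.rowLen i ∧ T.entry i j ≤ k := by
  rw [← mem_range, ← filter_entry_le_eq_range, mem_filter, mem_range]

theorem countAbove_succ (i k : ℕ) :
    T.countAbove (i + 1) k + T.rowCount i k = T.countAbove i k + T.rowCount i (k + 1) := by
  rw [countAbove, card_filter_fst_lt_succ,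
    card_filter_fst_eq _ i (Finset.Ico (T.rowCount i k) (T.rowCount i (k + 1))), Nat.card_Ico,
    ← countAbove]
  · have : T.rowCount i k ≤ T.rowCount i (k + 1) :=
      card_le_card fun j => by simp only [mem_filter, and_imp]; exact fun h h' => ⟨h, by omega⟩
    omega
  · intro j
    rw [mem_filter, Finset.mem_Ico, T.lt_rowCount_iff, ← not_lt, T.lt_rowCount_iff,
      mem_skewCells_iff]
    simp only
    constructor
    · rintro ⟨⟨h1, h2⟩, h3⟩
      omega
    · rintro ⟨h1, h2, h3⟩
      have h4 : T.entry i j = k + 1 := by omega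
      by_cases h : (i, j) ∈ skewCells α γ
      · exact ⟨mem_skewCells_iff.1 h, h4⟩
      · have := T.zeros i j h
        omega

theorem rowCount_strip (i k : ℕ) : T.rowCount (i + 1) (k + 1) ≤ T.rowCount i k := by
  by_contra! hlt
  have h1 := T.lt_rowCount_iff.1 hlt
  have h2 : T.rowCount i k < γ.rowLen i := h1.1.trans_le (γ.rowLen_anti _ _ (Nat.le_succ i))
  have h3 := mt T.lt_rowCount_iff.2 (lt_irrefl (T.rowCount i k))
  by_cases h : (i, T.rowCount i k) ∈ skewCells α γ
  · have h' : (i + 1, T.rowCount i k) ∈ skewCells α γ := by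
      rw [mem_skewCells_iff] at h ⊢
      exact ⟨(α.rowLen_anti _ _ (Nat.le_succ i)).trans h.1, h1.1⟩
    have := T.col_strict i (i + 1) _ (Nat.lt_succ_self i) h h'
    exact h3 ⟨h2, by omega⟩
  · exact h3 ⟨h2, by rw [T.zeros _ _ h]; exact Nat.zero_le _⟩

theorem countAbove_le_succ (i k : ℕ) : T.countAbove i k ≤ T.countAbove (i + 1) k :=
  card_le_card fun d => by
    simp only [mem_filter, and_imp]
    exact fun h h' h'' => ⟨⟨h, h'⟩, by omega⟩

/-- Stop reading at the leftmost `k + 2` of row `i`: every `k + 2` of the row has been read but no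
`k + 1` of it, so the ballot condition there is the claim. If the row has no `k + 2`, nothing is
added and `h` suffices. -/
theorem countAbove_strip_aux (i k : ℕ) (h : T.countAbove i (k + 1) ≤ T.countAbove i k) :
    T.countAbove (i + 1) (k + 1) ≤ T.countAbove i k := by
  rcases le_or_gt (T.rowCount i (k + 1 + 1)) (T.rowCount i (k + 1)) with hle | hlt
  · have := T.countAbove_succ i (k + 1)
    omega
  · obtain ⟨hj, hj'⟩ := T.lt_rowCount_iff.1 hlt
    have hj2 : ¬ T.entry i (T.rowCount i (k + 1)) ≤ k + 1 := fun h' =>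
      lt_irrefl _ (T.lt_rowCount_iff.2 ⟨hj, h'⟩)
    have hm : (i, T.rowCount i (k + 1)) ∈ skewCells α γ := by
      by_contra hm
      have := T.zeros _ _ hm
      omega
    refine le_trans (card_le_card fun d hd => ?_)
      ((T.ballot _ hm (k + 1) (by omega)).trans (card_le_card fun d hd => ?_))
    · simp only [readUpTo, mem_filter] at hd ⊢
      refine ⟨⟨hd.1.1, ?_⟩, hd.1.2⟩
      rcases Nat.lt_succ_iff_lt_or_eq.1 hd.2 with h1 | rfl
      · exact Or.inl h1
      · refine Or.inr ⟨rfl, ?_⟩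
        by_contra! h2
        have := (T.lt_rowCount_iff.1 h2).2
        omega
    · simp only [readUpTo, mem_filter] at hd ⊢
      refine ⟨⟨hd.1.1, hd.2⟩, ?_⟩
      rcases hd.1.2 with h1 | ⟨rfl, h1⟩
      · exact h1
      · have := T.entry_mono h1 (mem_skewCells_iff.1 hd.1.1).2
        omega

theorem countAbove_strip (i k : ℕ) : T.countAbove (i + 1) (k + 1) ≤ T.countAbove i k := by
  induction i generalizing k with
  | zero => exact T.countAbove_strip_aux _ _ (by simp [countAbove])
  | succ i ih => exact T.countAbove_strip_aux _ _ ((ih k).trans (T.countAbove_le_succ i k))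

/-- The pattern of a tableau. -/
def toPattern : LRPattern α.rowLen β.rowLen γ.rowLen where
  G := T.rowCount
  C := T.countAbove
  G_zero i := by
    refine le_antisymm ?_ ?_
    · by_contra! hlt
      have h := T.lt_rowCount_iff.1 hlt
      have := T.pos i _ (mem_skewCells_iff.2 ⟨le_rfl, h.1⟩)
      omega
    · by_contra! hlt
      refine lt_irrefl (T.rowCount i 0) (T.lt_rowCount_iff.2 ⟨?_, ?_⟩)
      · exact hlt.trans_le (rowLen_le_of_le T.le i)
      · rw [T.zeros _ _ fun h => ?_]
        have := (mem_skewCells_iff.1 h).1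
        omega
  G_top := by
    refine ⟨β.colLen 0, fun i k hk => ?_⟩
    rw [rowCount, filter_true_of_mem, card_range]
    exact fun j _ => (entry_le T i j).trans hk
  G_mono i k := card_le_card fun j => by
    simp only [mem_filter, and_imp]
    exact fun h h' => ⟨h, by omega⟩
  G_strip := T.rowCount_strip
  C_zero k := by simp [countAbove]
  C_top := by
    refine ⟨γ.colLen 0, fun i k hi => ?_⟩
    rw [← T.content k, countAbove, filter_filter]
    congr 1
    refine filter_congr fun c hc => ?_
    have := fst_lt_of_mem_skewCells hc
    simp [this.trans_le hi]
  step := T.countAbove_succ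
  C_strip := T.countAbove_strip

theorem toPattern_injective {T S : LRTableau α β γ}
    (h : ∀ i k, T.toPattern.G i k = S.toPattern.G i k) : T = S := by
  ext i j
  by_cases hj : j < γ.rowLen i
  · have key : ∀ k, T.entry i j ≤ k ↔ S.entry i j ≤ k := fun k => by
      have h1 := T.lt_rowCount_iff (i := i) (j := j) (k := k)
      have h2 := S.lt_rowCount_iff (i := i) (j := j) (k := k)
      have h3 : T.rowCount i k = S.rowCount i k := h i k
      rw [h3] at h1
      tauto
    exact le_antisymm ((key _).2 le_rfl) ((key _).1 le_rfl)
  · have : (i, j) ∉ skewCells α γ := fun h => hj (mem_skewCells_iff.1 h).2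
    rw [T.zeros i j this, S.zeros i j this]

end LRTableau

end

/-! ### Sufficiency: uniqueness of the contributing triple and of its tableaux -/

section

/-- All but the first value vanish, or all values are at most `1`: the row lengths of a row or
of a column. -/
def Thin (f : ℕ → ℕ) : Prop := (∀ i, 1 ≤ i → f i = 0) ∨ ∀ i, f i ≤ 1

theorem Thin.comparable {f g h : ℕ → ℕ} (hh : Thin h) (hf : Antitone f) (hg : Antitone g)
    (hfh : f ≤ h) (hgh : g ≤ h) : f ≤ g ∨ g ≤ f := by
  rcases hh with hh | hh
  · have key : ∀ {f g : ℕ → ℕ}, f ≤ h → f 0 ≤ g 0 → f ≤ g := fun {f g} hf h0 i => by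
      rcases Nat.eq_zero_or_pos i with rfl | hi
      · exact h0
      · have : f i ≤ h i := hf i
        rw [hh i hi, Nat.le_zero] at this
        exact this.le.trans (Nat.zero_le _)
    exact (le_total (f 0) (g 0)).imp (key hfh) (key hgh)
  · by_contra! hne
    simp only [Pi.le_def, not_forall, not_le] at hne
    obtain ⟨⟨i, hi⟩, j, hj⟩ := hne
    have h1 : f i ≤ 1 := (hfh i).trans (hh i)
    have h2 : g j ≤ 1 := (hgh j).trans (hh j)
    rcases le_total i j with hij | hij
    · have := hg hij
      omega
    · have := hf hij
      omega

theorem eq_of_comparable_of_sum_eq {f g : ℕ → ℕ} (h : f ≤ g ∨ g ≤ f) {N : ℕ}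
    (hs : ∀ n, N ≤ n → ∑ i ∈ range n, f i = ∑ i ∈ range n, g i) : f = g := by
  funext i
  have hs' := hs (max N (i + 1)) (le_max_left _ _)
  have hi : i ∈ range (max N (i + 1)) := mem_range.2 (Nat.lt_of_lt_of_le (Nat.lt_succ_self i)
    (le_max_right _ _))
  rcases h with h | h
  · exact (sum_eq_sum_iff_of_le fun i _ => h i).1 hs' i hi
  · exact ((sum_eq_sum_iff_of_le fun i _ => h i).1 hs'.symm i hi).symm

namespace LRPattern

variable {b c c' l : ℕ → ℕ} (P : LRPattern b c l)

theorem sum_G_succ (n k : ℕ) :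
    ∑ i ∈ range n, P.G i (k + 1) = ∑ i ∈ range n, P.G i k + P.C n k := by
  induction n with
  | zero => simp [P.C_zero]
  | succ n ih =>
    rw [sum_range_succ, sum_range_succ, ih]
    have := P.step n k
    omega

theorem sum_G (n k : ℕ) :
    ∑ i ∈ range n, P.G i k = ∑ i ∈ range n, b i + ∑ j ∈ range k, P.C n j := by
  induction k with
  | zero => simp [P.G_zero]
  | succ k ih => rw [sum_G_succ, ih, sum_range_succ, add_assoc]

theorem sum_outer {n k : ℕ} (h : n ≤ k) :
    ∑ i ∈ range n, l i = ∑ i ∈ range n, b i + ∑ j ∈ range k, P.C n j := by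
  rw [← sum_G]
  exact sum_congr rfl fun i hi => (P.G_eq_top ((mem_range.1 hi).trans_le h)).symm

theorem exists_sum_outer_eq (P : LRPattern b c l) : ∃ N, ∀ n, N ≤ n →
    ∑ i ∈ range n, l i = ∑ i ∈ range n, b i + ∑ k ∈ range n, c k := by
  obtain ⟨I, hI⟩ := P.C_top
  refine ⟨I, fun n hn => ?_⟩
  rw [P.sum_outer le_rfl]
  congr 1
  exact sum_congr rfl fun k _ => hI n k hn

/-- Column strictness followed along a diagonal down to `G m 0`, the inner row. -/
theorem G_add_le (m k : ℕ) : P.G (k + m) k ≤ b m := by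
  induction k with
  | zero => simp [P.G_zero]
  | succ k ih =>
    rw [Nat.add_right_comm]
    exact (P.G_strip _ _).trans ih

theorem C_add_le (m k : ℕ) : P.C (m + k) k ≤ P.C m 0 := by
  induction k with
  | zero => rfl
  | succ k ih => exact (P.C_strip _ _).trans ih

theorem G_antitone (k : ℕ) : Antitone fun i => P.G i k :=
  antitone_nat_of_succ_le fun _ => (P.G_mono _ _).trans (P.G_strip _ _)

theorem C_antitone (i : ℕ) : Antitone (P.C i) :=
  antitone_nat_of_succ_le fun k => (P.C_monotone (k + 1) (Nat.le_succ i)).trans (P.C_strip _ _)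

/-- For fixed `k`, rows above `k` are full, and the remaining row counts form a partition inside the
thin shape `b`. Its size is fixed by `b`, `l` and the first `k` parts of `c`, and subpartitions of a
thin shape are determined by size. -/
theorem G_eq_of_thin_inner (hb : Thin b) (P Q : LRPattern b c l) : P.G = Q.G := by
  funext i k
  rcases lt_or_ge i k with h | h
  · rw [P.G_eq_top h, Q.G_eq_top h]
  obtain ⟨m, rfl⟩ := Nat.exists_eq_add_of_le h
  obtain ⟨I, hI⟩ := P.C_top
  obtain ⟨J, hJ⟩ := Q.C_top
  have hcmp := hb.comparable (f := fun m => P.G (k + m) k) (g := fun m => Q.G (k + m) k)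
    (fun x y h => P.G_antitone k (by omega)) (fun x y h => Q.G_antitone k (by omega))
    (fun m => P.G_add_le m k) (fun m => Q.G_add_le m k)
  refine congrFun (eq_of_comparable_of_sum_eq hcmp (N := max I J) fun n hn => ?_) m
  have hP := P.sum_G (k + n) k
  have hQ := Q.sum_G (k + n) k
  rw [sum_range_add] at hP hQ
  have h1 : ∑ i ∈ range k, P.G i k = ∑ i ∈ range k, Q.G i k := sum_congr rfl fun i hi => by
    rw [P.G_eq_top (mem_range.1 hi), Q.G_eq_top (mem_range.1 hi)]
  have h2 : ∑ j ∈ range k, P.C (k + n) j = ∑ j ∈ range k, Q.C (k + n) j :=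
    sum_congr rfl fun _ _ => by rw [hI _ _ (by omega), hJ _ _ (by omega)]
  omega

theorem G_eq_of_C_eq {P Q : LRPattern b c l} (h : P.C = Q.C) : P.G = Q.G := by
  funext i k
  induction k with
  | zero => rw [P.G_zero, Q.G_zero]
  | succ k ih =>
    have h1 := P.step i k
    have h2 := Q.step i k
    rw [h] at h1
    omega

/-- The content of the first `i` rows is a partition inside the thin shape `c`, and its size is the
number of skew cells in those rows; so `C` is determined, and `G` with it. -/
theorem G_eq_of_thin_content (hc : Thin c) (P Q : LRPattern b c l) : P.G = Q.G := by
  refine G_eq_of_C_eq (funext fun i => ?_)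
  refine eq_of_comparable_of_sum_eq (hc.comparable (P.C_antitone i) (Q.C_antitone i)
    (P.C_le i) (Q.C_le i)) (N := i) fun n hn => ?_
  have h1 := P.sum_outer hn
  have h2 := Q.sum_outer hn
  omega

/-- The letters `k + 1` occupy distinct columns and first occur in row `k` or below, so those
through row `k + n` fit between column `G (k + n) k` and the end of row `k`. -/
theorem C_add_G_le (n k : ℕ) : P.C (k + n + 1) k + P.G (k + n) k ≤ l k := by
  induction n with
  | zero =>
    have := P.step k k
    rw [P.C_eq_zero le_rfl, P.G_eq_top (Nat.lt_succ_self k)] at this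
    simpa using this.le
  | succ n ih =>
    have h1 := P.step (k + n + 1) k
    have h2 := P.G_strip (k + n) k
    rw [← add_assoc]
    omega

theorem content_le (P : LRPattern b c l) : c ≤ l := fun k => by
  obtain ⟨I, hI⟩ := P.C_top
  have := P.C_add_G_le I k
  rw [hI _ _ (by omega)] at this
  exact (Nat.le_add_right _ _).trans this

theorem inner_le (P : LRPattern b c l) : b ≤ l := fun i => (P.le_G i 0).trans (P.G_le i 0)

theorem content_eq_of_inner_eq_zero (P : LRPattern b c l) (hb : b = 0) : c = l := by
  obtain ⟨N, hN⟩ := P.exists_sum_outer_eq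
  refine eq_of_comparable_of_sum_eq (Or.inl P.content_le) (N := N) fun n hn => ?_
  simp [hN n hn, hb]

theorem inner_eq_of_content_eq_zero (P : LRPattern b c l) (hc : c = 0) : b = l := by
  obtain ⟨N, hN⟩ := P.exists_sum_outer_eq
  refine eq_of_comparable_of_sum_eq (Or.inl P.inner_le) (N := N) fun n hn => ?_
  simp [hN n hn, hc]

/-- If the outer shape is a rectangle, the content is the rotated complement of the inner shape. -/
theorem content_eq_of_rectangle {r w : ℕ} (hl : ∀ i, l i = if i < r then w else 0)
    (P : LRPattern b c l) (k : ℕ) : c k = if k < r then w - b (r - 1 - k) else 0 := by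
  have hstable : ∀ n, P.C (r + n) k = P.C r k := fun n => by
    induction n with
    | zero => rfl
    | succ n ih =>
      have h1 := P.step (r + n) k
      have h2 := P.G_le (r + n) (k + 1)
      have h3 := P.G_le (r + n) k
      rw [hl, if_neg (by omega)] at h2 h3
      rw [← add_assoc]
      omega
  have hc : c k = P.C r k := by
    obtain ⟨I, hI⟩ := P.C_top
    rw [← hstable I, hI _ _ (by omega)]
  rw [hc]
  split_ifs with hk
  · have hbw : ∀ i, i < r → b i ≤ w := fun i hi => by
      have := P.inner_le i
      rwa [hl, if_pos hi] at this
    -- The diagonal ballot inequality bounds the letters `k + 1` by the letters 1 in the first `r -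
    -- k` rows, which lie to the right of the inner row `r - 1 - k`. Both sides have the same sum
    -- over `k`, so every bound is an equality.
    have hle : ∀ k ∈ range r, P.C r k ≤ w - b (r - 1 - k) := fun k hk => by
      have hk := mem_range.1 hk
      have h1 := P.C_add_le (r - 1 - k + 1) k
      have h2 := P.C_add_G_le (r - 1 - k) 0
      rw [show r - 1 - k + 1 + k = r by omega] at h1
      rw [zero_add, P.G_zero, hl, if_pos (by omega)] at h2
      omega
    refine (sum_eq_sum_iff_of_le hle).1 ?_ k (mem_range.2 hk)
    rw [sum_range_reflect (fun i => w - b i)]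
    have h1 := P.sum_outer (le_refl r)
    have h2 : ∑ i ∈ range r, (w - b i) + ∑ i ∈ range r, b i = ∑ i ∈ range r, l i := by
      rw [← sum_add_distrib]
      refine sum_congr rfl fun i hi => ?_
      have hi := mem_range.1 hi
      rw [hl, if_pos hi, Nat.sub_add_cancel (hbw i hi)]
    omega
  · exact P.C_eq_zero (by omega)

end LRPattern

variable {α β γ μ ν lam : YoungDiagram}

theorem ext_rowLen (h : α.rowLen = β.rowLen) : α = β := by
  refine YoungDiagram.ext (Finset.ext ?_)
  rintro ⟨i, j⟩
  rw [YoungDiagram.mem_cells, YoungDiagram.mem_cells, YoungDiagram.mem_iff_lt_rowLen,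
    YoungDiagram.mem_iff_lt_rowLen, h]

theorem rowLen_eq_zero_of_colLen_le {i : ℕ} (h : μ.colLen 0 ≤ i) : μ.rowLen i = 0 := by
  by_contra h0
  have : (i, 0) ∈ μ := YoungDiagram.mem_iff_lt_rowLen.2 (Nat.pos_of_ne_zero h0)
  rw [YoungDiagram.mem_iff_lt_colLen] at this
  omega

theorem rowLen_bot : (⊥ : YoungDiagram).rowLen = 0 := by
  funext i
  by_contra h0
  exact YoungDiagram.notMem_bot (i, 0) (YoungDiagram.mem_iff_lt_rowLen.2 (Nat.pos_of_ne_zero h0))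

theorem card_eq_sum_rowLen {n : ℕ} (h : μ.colLen 0 ≤ n) :
    μ.card = ∑ i ∈ range n, μ.rowLen i := by
  have hmaps : ∀ c ∈ μ.cells, c.1 ∈ range n := by
    rintro ⟨i, j⟩ hc
    rw [mem_range]
    by_contra! hi
    rw [YoungDiagram.mem_cells, YoungDiagram.mem_iff_lt_rowLen,
      rowLen_eq_zero_of_colLen_le (h.trans hi)] at hc
    omega
  rw [YoungDiagram.card, card_eq_sum_card_fiberwise hmaps]
  exact sum_congr rfl fun i _ => by rw [YoungDiagram.rowLen_eq_card]; rfl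

theorem LRPattern.card_add_card (P : LRPattern α.rowLen β.rowLen γ.rowLen) :
    α.card + β.card = γ.card := by
  obtain ⟨N, hN⟩ := P.exists_sum_outer_eq
  have := hN (max N (max (α.colLen 0) (max (β.colLen 0) (γ.colLen 0)))) (le_max_left _ _)
  rw [← card_eq_sum_rowLen (by simp), ← card_eq_sum_rowLen (by simp),
    ← card_eq_sum_rowLen (by simp)] at this
  exact this.symm

theorem lrCoeff_le_one_of_thin_inner (h : Thin α.rowLen) : lrCoeff α β γ ≤ 1 :=
  Finite.card_le_one_iff_subsingleton.2 ⟨fun T S => LRTableau.toPattern_injective fun i k => by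
    rw [LRPattern.G_eq_of_thin_inner h T.toPattern S.toPattern]⟩

theorem lrCoeff_le_one_of_thin_content (h : Thin β.rowLen) : lrCoeff α β γ ≤ 1 :=
  Finite.card_le_one_iff_subsingleton.2 ⟨fun T S => LRTableau.toPattern_injective fun i k => by
    rw [LRPattern.G_eq_of_thin_content h T.toPattern S.toPattern]⟩

theorem nonempty_pattern (h : lrCoeff α β γ ≠ 0) :
    Nonempty (LRPattern α.rowLen β.rowLen γ.rowLen) :=
  (nonempty_of_lrCoeff_ne_zero h).map LRTableau.toPattern

theorem Thin.mono {f g : ℕ → ℕ} (hg : Thin g) (h : f ≤ g) : Thin f :=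
  hg.imp (fun hg i hi => Nat.le_zero.1 ((h i).trans (hg i hi).le)) fun hg i => (h i).trans (hg i)

theorem eq_of_thin (hμ : Thin μ.rowLen) (hα : α.rowLen ≤ μ.rowLen) (hβ : β.rowLen ≤ μ.rowLen)
    (h : α.card = β.card) : α = β := by
  refine ext_rowLen (eq_of_comparable_of_sum_eq
    (hμ.comparable (fun _ _ => α.rowLen_anti _ _) (fun _ _ => β.rowLen_anti _ _) hα hβ)
    (N := max (α.colLen 0) (β.colLen 0)) fun n hn => ?_)
  rw [← card_eq_sum_rowLen (le_of_max_le_left hn), ← card_eq_sum_rowLen (le_of_max_le_right hn), h]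

theorem rowLen_eq_zero_of_card_eq_zero (h : μ.card = 0) : μ.rowLen = 0 := by
  rw [← rowLen_bot, show μ = ⊥ from YoungDiagram.ext (Finset.card_eq_zero.1 h)]

theorem content_eq_of_card_inner_eq_zero (P : LRPattern α.rowLen β.rowLen γ.rowLen)
    (h : α.card = 0) : β = γ :=
  ext_rowLen (P.content_eq_of_inner_eq_zero (rowLen_eq_zero_of_card_eq_zero h))

theorem inner_eq_of_card_content_eq_zero (P : LRPattern α.rowLen β.rowLen γ.rowLen)
    (h : β.card = 0) : α = γ :=
  ext_rowLen (P.inner_eq_of_content_eq_zero (rowLen_eq_zero_of_card_eq_zero h))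

theorem rowLen_of_cells_eq {r w : ℕ} (h : μ.cells = range r ×ˢ range w) (i : ℕ) :
    μ.rowLen i = if i < r then w else 0 := by
  refine eq_of_forall_lt_iff fun j => ?_
  rw [← YoungDiagram.mem_iff_lt_rowLen, ← YoungDiagram.mem_cells, h, mem_product, mem_range,
    mem_range]
  split_ifs <;> simp [*]

theorem content_eq_of_isRectangle {β' : YoungDiagram} (h : IsRectangle γ)
    (P : LRPattern α.rowLen β.rowLen γ.rowLen) (Q : LRPattern α.rowLen β'.rowLen γ.rowLen) :
    β = β' := by
  obtain ⟨r, w, -, -, h⟩ := h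
  refine ext_rowLen (funext fun k => ?_)
  rw [P.content_eq_of_rectangle (rowLen_of_cells_eq h),
    Q.content_eq_of_rectangle (rowLen_of_cells_eq h)]

theorem nlNumber_eq_zero_or_one
    (h1 : ∀ a b g, lrCoeff a b μ ≠ 0 → lrCoeff a g ν ≠ 0 → lrCoeff b g lam ≠ 0 →
      lrCoeff a b μ ≤ 1 ∧ lrCoeff a g ν ≤ 1 ∧ lrCoeff b g lam ≤ 1)
    (h2 : ∀ a b g a' b' g', lrCoeff a b μ ≠ 0 → lrCoeff a g ν ≠ 0 → lrCoeff b g lam ≠ 0 →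
      lrCoeff a' b' μ ≠ 0 → lrCoeff a' g' ν ≠ 0 → lrCoeff b' g' lam ≠ 0 →
      a = a' ∧ b = b' ∧ g = g') :
    nlNumber μ ν lam = 0 ∨ nlNumber μ ν lam = 1 := by
  by_cases hz : ∀ t : YoungDiagram × YoungDiagram × YoungDiagram,
      lrCoeff t.1 t.2.1 μ * lrCoeff t.1 t.2.2 ν * lrCoeff t.2.1 t.2.2 lam = 0
  · left
    rw [nlNumber]
    simp only [hz, finsum_zero]
  · right
    push Not at hz
    obtain ⟨⟨a, b, g⟩, hz⟩ := hz
    have hz' : (lrCoeff a b μ ≠ 0 ∧ lrCoeff a g ν ≠ 0) ∧ lrCoeff b g lam ≠ 0 := by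
      simpa [mul_ne_zero_iff] using hz
    rw [nlNumber, finsum_eq_single _ (a, b, g)]
    · obtain ⟨h3, h4, h5⟩ := h1 a b g hz'.1.1 hz'.1.2 hz'.2
      simp only
      rw [show lrCoeff a b μ = 1 by omega, show lrCoeff a g ν = 1 by omega,
        show lrCoeff b g lam = 1 by omega]
    · rintro ⟨a', b', g'⟩ hne
      by_contra h
      have h' : (lrCoeff a' b' μ ≠ 0 ∧ lrCoeff a' g' ν ≠ 0) ∧ lrCoeff b' g' lam ≠ 0 := by
        simpa [mul_ne_zero_iff] using h
      obtain ⟨rfl, rfl, rfl⟩ :=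
        h2 a b g a' b' g' hz'.1.1 hz'.1.2 hz'.2 h'.1.1 h'.1.2 h'.2
      exact hne rfl

/-- Sizes determine α and β inside the thin μ; then γ is the complement in a rectangle, or one of α,
β is empty and γ equals ν or λ. -/
theorem isNLMultiplicityFree_of_thin_left (hμ : Thin μ.rowLen)
    (h : μ.card ≤ 1 ∨ IsRectangle ν) : IsNLMultiplicityFree μ ν := by
  refine fun lam => nlNumber_eq_zero_or_one ?_ ?_
  · intro a b g h1 h2 h3
    obtain ⟨P⟩ := nonempty_pattern h1
    have ha := hμ.mono P.inner_le
    exact ⟨lrCoeff_le_one_of_thin_inner ha, lrCoeff_le_one_of_thin_inner ha,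
      lrCoeff_le_one_of_thin_inner (hμ.mono P.content_le)⟩
  · intro a b g a' b' g' h1 h2 h3 h1' h2' h3'
    obtain ⟨P1⟩ := nonempty_pattern h1
    obtain ⟨P2⟩ := nonempty_pattern h2
    obtain ⟨P3⟩ := nonempty_pattern h3
    obtain ⟨Q1⟩ := nonempty_pattern h1'
    obtain ⟨Q2⟩ := nonempty_pattern h2'
    obtain ⟨Q3⟩ := nonempty_pattern h3'
    have c1 := P1.card_add_card
    have c2 := P2.card_add_card
    have c3 := P3.card_add_card
    have d1 := Q1.card_add_card
    have d2 := Q2.card_add_card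
    have d3 := Q3.card_add_card
    obtain rfl : a = a' := eq_of_thin hμ P1.inner_le Q1.inner_le (by omega)
    obtain rfl : b = b' := eq_of_thin hμ P1.content_le Q1.content_le (by omega)
    refine ⟨rfl, rfl, ?_⟩
    rcases h with h | h
    · rcases Nat.eq_zero_or_pos a.card with h0 | h0
      · rw [content_eq_of_card_inner_eq_zero P2 h0, content_eq_of_card_inner_eq_zero Q2 h0]
      · have h0 : b.card = 0 := by omega
        rw [content_eq_of_card_inner_eq_zero P3 h0, content_eq_of_card_inner_eq_zero Q3 h0]
    · exact content_eq_of_isRectangle h P2 Q2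

theorem isNLMultiplicityFree_of_thin_right (hν : Thin ν.rowLen)
    (h : ν.card ≤ 1 ∨ IsRectangle μ) : IsNLMultiplicityFree μ ν := by
  refine fun lam => nlNumber_eq_zero_or_one ?_ ?_
  · intro a b g h1 h2 h3
    obtain ⟨P⟩ := nonempty_pattern h2
    have ha := hν.mono P.inner_le
    exact ⟨lrCoeff_le_one_of_thin_inner ha, lrCoeff_le_one_of_thin_inner ha,
      lrCoeff_le_one_of_thin_content (hν.mono P.content_le)⟩
  · intro a b g a' b' g' h1 h2 h3 h1' h2' h3'
    obtain ⟨P1⟩ := nonempty_pattern h1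
    obtain ⟨P2⟩ := nonempty_pattern h2
    obtain ⟨P3⟩ := nonempty_pattern h3
    obtain ⟨Q1⟩ := nonempty_pattern h1'
    obtain ⟨Q2⟩ := nonempty_pattern h2'
    obtain ⟨Q3⟩ := nonempty_pattern h3'
    have c1 := P1.card_add_card
    have c2 := P2.card_add_card
    have c3 := P3.card_add_card
    have d1 := Q1.card_add_card
    have d2 := Q2.card_add_card
    have d3 := Q3.card_add_card
    obtain rfl : a = a' := eq_of_thin hν P2.inner_le Q2.inner_le (by omega)
    obtain rfl : g = g' := eq_of_thin hν P2.content_le Q2.content_le (by omega)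
    refine ⟨rfl, ?_, rfl⟩
    rcases h with h | h
    · rcases Nat.eq_zero_or_pos a.card with h0 | h0
      · rw [content_eq_of_card_inner_eq_zero P1 h0, content_eq_of_card_inner_eq_zero Q1 h0]
      · have h0 : g.card = 0 := by omega
        rw [inner_eq_of_card_content_eq_zero P3 h0, inner_eq_of_card_content_eq_zero Q3 h0]
    · exact content_eq_of_isRectangle h P1 Q1

theorem IsSingleRow.thin (h : IsSingleRow μ) : Thin μ.rowLen := by
  obtain ⟨w, -, h⟩ := h
  refine Or.inl fun i hi => ?_
  by_contra h0
  have : (i, 0) ∈ μ.cells := (YoungDiagram.mem_cells _).2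
    (YoungDiagram.mem_iff_lt_rowLen.2 (Nat.pos_of_ne_zero h0))
  rw [h, mem_product, mem_singleton] at this
  have := this.1
  simp only at this
  omega

theorem IsSingleColumn.thin (h : IsSingleColumn μ) : Thin μ.rowLen := by
  obtain ⟨w, -, h⟩ := h
  refine Or.inr fun i => ?_
  by_contra! h0
  have : (i, 1) ∈ μ.cells := (YoungDiagram.mem_cells _).2 (YoungDiagram.mem_iff_lt_rowLen.2 h0)
  rw [h, mem_product, mem_singleton] at this
  exact absurd this.2 one_ne_zero

theorem thin_bot : Thin (⊥ : YoungDiagram).rowLen := by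
  rw [rowLen_bot]
  exact Or.inl fun _ _ => rfl

theorem IsSingleBox.isSingleRow (h : IsSingleBox μ) : IsSingleRow μ :=
  ⟨1, le_rfl, by rw [show μ.cells = {(0, 0)} from h]; rfl⟩

theorem IsSingleBox.card_eq (h : IsSingleBox μ) : μ.card = 1 := by
  rw [YoungDiagram.card, show μ.cells = {(0, 0)} from h, card_singleton]

theorem isNLMultiplicityFree_of_cases
    (h : (μ = ⊥ ∨ IsSingleBox μ ∨ ν = ⊥ ∨ IsSingleBox ν) ∨
      ((IsSingleRow μ ∧ IsRectangle ν) ∨ (IsSingleRow ν ∧ IsRectangle μ)) ∨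
      ((IsSingleColumn μ ∧ IsRectangle ν) ∨ (IsSingleColumn ν ∧ IsRectangle μ))) :
    IsNLMultiplicityFree μ ν := by
  rcases h with (rfl | h | rfl | h) | (⟨h, h'⟩ | ⟨h, h'⟩) | (⟨h, h'⟩ | ⟨h, h'⟩)
  · exact isNLMultiplicityFree_of_thin_left thin_bot (Or.inl (by simp [YoungDiagram.card]))
  · exact isNLMultiplicityFree_of_thin_left h.isSingleRow.thin (Or.inl h.card_eq.le)
  · exact isNLMultiplicityFree_of_thin_right thin_bot (Or.inl (by simp [YoungDiagram.card]))
  · exact isNLMultiplicityFree_of_thin_right h.isSingleRow.thin (Or.inl h.card_eq.le)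
  · exact isNLMultiplicityFree_of_thin_left h.thin (Or.inr h')
  · exact isNLMultiplicityFree_of_thin_right h.thin (Or.inr h')
  · exact isNLMultiplicityFree_of_thin_left h.thin (Or.inr h')
  · exact isNLMultiplicityFree_of_thin_right h.thin (Or.inr h')

end

/-! ### Explicit patterns built from vertical segments -/

section

/-- The row lengths of a single column of length `n`. -/
def col (n i : ℕ) : ℕ := if i < n then 1 else 0

/-- The number of cells of row `i` with entry at most `k` in a vertical segment of `n` cells that
starts in row `p` and has entries `e + 1, …, e + n`. -/
def segG (p n e i k : ℕ) : ℕ := if p ≤ i ∧ i < p + n ∧ i + e < k + p then 1 else 0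

/-- The number of entries `k + 1` above row `i` in a vertical segment of `n` cells that starts in
row `p` and has entries `e + 1, …, e + n`. -/
def segC (p n e i k : ℕ) : ℕ := if e ≤ k ∧ k < e + n ∧ k + p < i + e then 1 else 0

theorem seg_step (p n e i k : ℕ) :
    segC p n e (i + 1) k + segG p n e i k = segC p n e i k + segG p n e i (k + 1) := by
  simp only [segC, segG]; grind

namespace LRPattern

/-- The empty tableau of inner shape `b`. -/
def empty {b : ℕ → ℕ} (hb : Antitone b) : LRPattern b 0 b where
  G i _ := b i
  C _ _ := 0
  G_zero _ := rfl
  G_top := ⟨0, fun _ _ _ => rfl⟩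
  G_mono _ _ := le_rfl
  G_strip i _ := hb (Nat.le_succ i)
  C_zero _ := rfl
  C_top := ⟨0, fun _ _ _ => rfl⟩
  step _ _ := rfl
  C_strip _ _ := le_rfl

/-- The tableau of straight shape `c` with all entries of the row `i` equal to `i + 1`. -/
def straight {c : ℕ → ℕ} (hc : Antitone c) (h : ∃ N, ∀ i, N ≤ i → c i = 0) :
    LRPattern 0 c c where
  G i k := if k ≤ i then 0 else c i
  C i k := if k < i then c k else 0
  G_zero _ := by simp
  G_top := by
    obtain ⟨N, hN⟩ := h
    refine ⟨N, fun i k hk => ?_⟩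
    split_ifs with hi
    · rw [hN i (by omega)]
    · rfl
  G_mono i k := by split_ifs <;> omega
  G_strip i k := by
    have := hc (Nat.le_succ i)
    split_ifs <;> omega
  C_zero _ := by simp
  C_top := by
    obtain ⟨N, hN⟩ := h
    refine ⟨N, fun i k hi => ?_⟩
    split_ifs with hk
    · rfl
    · rw [hN k (by omega)]
  step i k := by
    rcases lt_trichotomy i k with h | rfl | h
    · rw [if_neg (by omega), if_neg (by omega), if_neg (by omega), if_neg (by omega)]
    · simp
    · rw [if_pos (by omega), if_pos (by omega), if_pos (by omega), if_pos (by omega)]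
  C_strip i k := by
    have := hc (Nat.le_succ k)
    split_ifs <;> omega

/-- Removing the bottom box of a column. -/
def columnBox (m : ℕ) : LRPattern (col 1) (col m) (col (m + 1)) where
  G i k := col 1 i + segG 1 m 0 i k
  C i k := segC 1 m 0 i k
  G_zero i := by simp only [col, segG]; grind
  G_top := ⟨m, fun i k h => by simp only [col, segG]; grind⟩
  G_mono i k := by simp only [col, segG]; grind
  G_strip i k := by simp only [col, segG]; grind
  C_zero k := by simp only [segC]; grind
  C_top := ⟨m + 1, fun i k h => by simp only [col, segC]; grind⟩
  step i k := by
    linarith [seg_step 1 m 0 i k]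
  C_strip i k := by simp only [segC]; grind

/-- A column times two columns, the longer of which has been shortened. -/
def columnMulLong (h i j : ℕ) (hh : 1 ≤ h) :
    LRPattern (col h) (col (i + 1) + col j) (col (i + 1) + col (j + h)) where
  G x k := col h x + segG h j 0 x k + segG 0 (i + 1) 0 x k
  C x k := segC h j 0 x k + segC 0 (i + 1) 0 x k
  G_zero x := by simp only [col, segG]; grind
  G_top := ⟨i + j + 1, fun x k _ => by simp only [col, segG, Pi.add_apply]; grind⟩
  G_mono x k := by simp only [col, segG]; grind
  G_strip x k := by simp only [col, segG]; grind
  C_zero k := by simp only [segC]; grind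
  C_top := ⟨h + i + j + 1, fun x k _ => by simp only [col, segC, Pi.add_apply]; grind⟩
  step x k := by
    linarith [seg_step h j 0 x k, seg_step 0 (i + 1) 0 x k]
  C_strip x k := by simp only [segC]; grind

/-- A column times two columns, the shorter of which has been shortened. -/
def columnMulShort (h i j : ℕ) (hh : 1 ≤ h) (hij : i < j) :
    LRPattern (col h) (col i + col (j + 1)) (col (i + 1) + col (j + h)) where
  -- The new column reads `1, …, i + 1`. The cells below the inner column read `1, …, i` and then `i
  -- + 2, …, j + 1`, skipping `i + 1`, which thus occurs only once.
  G x k := col h x + segG 0 (i + 1) 0 x k + segG h i 0 x k + segG (h + i) (j - i) (i + 1) x k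
  C x k := segC 0 (i + 1) 0 x k + segC h i 0 x k + segC (h + i) (j - i) (i + 1) x k
  G_zero x := by simp only [col, segG]; grind
  G_top := ⟨j + 2, fun x k _ => by simp only [col, segG, Pi.add_apply]; grind⟩
  G_mono x k := by simp only [col, segG]; grind
  G_strip x k := by simp only [col, segG]; grind
  C_zero k := by simp only [segC]; grind
  C_top := ⟨h + j + 2, fun x k _ => by simp only [col, segC, Pi.add_apply]; grind⟩
  step x k := by
    linarith [seg_step 0 (i + 1) 0 x k, seg_step h i 0 x k, seg_step (h + i) (j - i) (i + 1) x k]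
  C_strip x k := by simp only [segC]; grind

/-- Two columns, the longer of which has been shortened, times a column. -/
def longMulColumn (h i j : ℕ) :
    LRPattern (col (i + 1) + col j) (col h) (col (i + 1) + col (j + h)) where
  G x k := col (i + 1) x + col j x + segG j h 0 x k
  C x k := segC j h 0 x k
  G_zero x := by simp only [col, segG, Pi.add_apply]; grind
  G_top := ⟨h, fun x k _ => by simp only [col, segG, Pi.add_apply]; grind⟩
  G_mono x k := by simp only [col, segG]; grind
  G_strip x k := by simp only [col, segG]; grind
  C_zero k := by simp only [segC]; grind
  C_top := ⟨j + h, fun x k _ => by simp only [col, segC]; grind⟩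
  step x k := by
    linarith [seg_step j h 0 x k]
  C_strip x k := by simp only [segC]; grind

/-- Two columns, the shorter of which has been shortened, times a column. -/
def shortMulColumn (h i j : ℕ) (hh : 1 ≤ h) (hij : i < j) :
    LRPattern (col i + col (j + 1)) (col h) (col (i + 1) + col (j + h)) where
  -- The letter 1 restores the box of the shorter column; the letters `2, …, h` extend the longer
  -- one.
  G x k := col i x + col (j + 1) x + segG i 1 0 x k + segG (j + 1) (h - 1) 1 x k
  C x k := segC i 1 0 x k + segC (j + 1) (h - 1) 1 x k
  G_zero x := by simp only [col, segG, Pi.add_apply]; grind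
  G_top := ⟨h + 1, fun x k _ => by simp only [col, segG, Pi.add_apply]; grind⟩
  G_mono x k := by simp only [col, segG]; grind
  G_strip x k := by simp only [col, segG]; grind
  C_zero k := by simp only [segC]; grind
  C_top := ⟨j + h + 1, fun x k _ => by simp only [col, segC]; grind⟩
  step x k := by
    linarith [seg_step i 1 0 x k, seg_step (j + 1) (h - 1) 1 x k]
  C_strip x k := by simp only [segC]; grind

/-- One of two tableaux for the product of two shortened rectangles of width two. -/
def twoColumns₁ (r s : ℕ) (hr : 1 ≤ r) (hs : 1 ≤ s) :
    LRPattern (col r + col (r + 1)) (col s + col (s + 1))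
      (col (r + s + 1) + col (r + s) + col 1) where
  -- The lone 1 in a new third column lets either of the two extended columns start with 2. Here it
  -- is the longer one; in the companion pattern it is the shorter one.
  G x k := col r x + col (r + 1) x + segG 0 1 0 x k + segG r s 0 x k + segG (r + 1) s 1 x k
  C x k := segC 0 1 0 x k + segC r s 0 x k + segC (r + 1) s 1 x k
  G_zero x := by simp only [col, segG, Pi.add_apply]; grind
  G_top := ⟨s + 1, fun x k _ => by simp only [col, segG, Pi.add_apply]; grind⟩
  G_mono x k := by simp only [col, segG]; grind
  G_strip x k := by simp only [col, segG]; grind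
  C_zero k := by simp only [segC]; grind
  C_top := ⟨r + s + 2, fun x k _ => by simp only [col, segC, Pi.add_apply]; grind⟩
  step x k := by
    linarith [seg_step 0 1 0 x k, seg_step r s 0 x k, seg_step (r + 1) s 1 x k]
  C_strip x k := by simp only [segC]; grind

/-- The other tableau for the product of two shortened rectangles of width two. -/
def twoColumns₂ (r s : ℕ) (hr : 1 ≤ r) (hs : 1 ≤ s) :
    LRPattern (col r + col (r + 1)) (col s + col (s + 1))
      (col (r + s + 1) + col (r + s) + col 1) where
  G x k := col r x + col (r + 1) x + segG 0 1 0 x k + segG r s 1 x k + segG (r + 1) s 0 x k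
  C x k := segC 0 1 0 x k + segC r s 1 x k + segC (r + 1) s 0 x k
  G_zero x := by simp only [col, segG, Pi.add_apply]; grind
  G_top := ⟨s + 1, fun x k _ => by simp only [col, segG, Pi.add_apply]; grind⟩
  G_mono x k := by simp only [col, segG]; grind
  G_strip x k := by simp only [col, segG]; grind
  C_zero k := by simp only [segC]; grind
  C_top := ⟨r + s + 2, fun x k _ => by simp only [col, segC, Pi.add_apply]; grind⟩
  step x k := by
    linarith [seg_step 0 1 0 x k, seg_step r s 1 x k, seg_step (r + 1) s 0 x k]
  C_strip x k := by simp only [segC]; grind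

end LRPattern

end

/-! ### Necessity: corners, and Newell-Littlewood numbers that are at least two -/

section

/-- The function lists the row lengths of a Young diagram. -/
def IsShape (f : ℕ → ℕ) : Prop := Antitone f ∧ ∃ N, ∀ i, N ≤ i → f i = 0

theorem IsShape.add {f g : ℕ → ℕ} (hf : IsShape f) (hg : IsShape g) : IsShape (f + g) := by
  obtain ⟨hf, M, hM⟩ := hf
  obtain ⟨hg, N, hN⟩ := hg
  refine ⟨hf.add hg, max M N, fun i hi => ?_⟩
  rw [Pi.add_apply, hM i (le_of_max_le_left hi), hN i (le_of_max_le_right hi)]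

theorem isShape_col (n : ℕ) : IsShape (col n) := by
  refine ⟨antitone_nat_of_succ_le fun i => ?_, n, fun i hi => ?_⟩ <;> simp only [col] <;> grind

theorem isShape_rowLen (μ : YoungDiagram) : IsShape μ.rowLen :=
  ⟨fun _ _ => μ.rowLen_anti _ _, μ.colLen 0, fun _ => rowLen_eq_zero_of_colLen_le⟩

theorem IsShape.exists_rowLen_eq {f : ℕ → ℕ} (hf : IsShape f) :
    ∃ μ : YoungDiagram, μ.rowLen = f := by
  obtain ⟨hf, N, hN⟩ := hf
  let μ : YoungDiagram :=
    { cells := (range N ×ˢ range (f 0)).filter fun c => c.2 < f c.1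
      isLowerSet := by
        rintro ⟨i, j⟩ ⟨i', j'⟩ ⟨hi, hj⟩ h
        simp only [coe_filter, mem_product, mem_range, Set.mem_ofPred_eq] at h ⊢
        have := hf hi
        simp only at hi hj this
        omega }
  refine ⟨μ, funext fun i => eq_of_forall_lt_iff fun j => ?_⟩
  rw [← YoungDiagram.mem_iff_lt_rowLen, ← YoungDiagram.mem_cells]
  simp only [μ, mem_filter, mem_product, mem_range]
  refine ⟨fun h => h.2, fun h => ⟨⟨?_, h.trans_le (hf (Nat.zero_le i))⟩, h⟩⟩
  by_contra! hi
  rw [hN i hi] at h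
  omega

/-- A corner in row `m` means that some column has height exactly `m + 1`; deleting that column
leaves a partition. -/
theorem IsShape.exists_eq_col_add {f : ℕ → ℕ} (hf : IsShape f) {m : ℕ} (hm : f (m + 1) < f m) :
    ∃ g, IsShape g ∧ f = col (m + 1) + g := by
  obtain ⟨hf, N, hN⟩ := hf
  refine ⟨fun i => f i - col (m + 1) i, ⟨antitone_nat_of_succ_le fun i => ?_, N, fun i hi => ?_⟩,
    funext fun i => ?_⟩
  · have := hf (Nat.le_succ i)
    simp only [col]
    grind
  · simp only [hN i hi, Nat.zero_sub]
  · have : i ≤ m → f m ≤ f i := fun h => hf h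
    simp only [col, Pi.add_apply]
    grind

theorem IsShape.exists_last_corner {f : ℕ → ℕ} (hf : IsShape f) (h0 : f 0 ≠ 0) :
    ∃ m, f (m + 1) < f m ∧ f (m + 1) = 0 := by
  classical
  have h : ∃ n, f n = 0 := hf.2.imp fun N hN => hN N le_rfl
  have hpos : Nat.find h ≠ 0 := fun h' => h0 <| by
    have := Nat.find_spec h
    rwa [h'] at this
  obtain ⟨m, hm⟩ := Nat.exists_eq_succ_of_ne_zero hpos
  have h1 : f (m + 1) = 0 := by
    rw [← Nat.succ_eq_add_one, ← hm]
    exact Nat.find_spec h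
  have h2 : f m ≠ 0 := Nat.find_min h (by omega)
  exact ⟨m, by omega, h1⟩

theorem isRectangle_of_rowLen {μ : YoungDiagram} {r w : ℕ} (hr : 1 ≤ r) (hw : 1 ≤ w)
    (h : ∀ i, μ.rowLen i = if i < r then w else 0) : IsRectangle μ := by
  refine ⟨r, w, hr, hw, Finset.ext ?_⟩
  rintro ⟨i, j⟩
  rw [YoungDiagram.mem_cells, YoungDiagram.mem_iff_lt_rowLen, h, mem_product, mem_range, mem_range]
  split_ifs <;> simp [*]

/-- If the last row ends in the only corner, all nonzero rows have the same length. -/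
theorem exists_two_corners {μ : YoungDiagram} (h0 : μ.rowLen 0 ≠ 0) (h : ¬ IsRectangle μ) :
    ∃ i j, i < j ∧ μ.rowLen (i + 1) < μ.rowLen i ∧ μ.rowLen (j + 1) < μ.rowLen j := by
  obtain ⟨j, hj, hj0⟩ := (isShape_rowLen μ).exists_last_corner h0
  by_contra! hne
  have hconst : ∀ i, i ≤ j → μ.rowLen i = μ.rowLen 0 := fun i => by
    induction i with
    | zero => exact fun _ => rfl
    | succ i ih =>
      intro hi
      rw [← ih (by omega)]
      refine le_antisymm (μ.rowLen_anti _ _ (Nat.le_succ i)) ?_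
      by_contra! hlt
      exact absurd (hne i j (by omega) hlt) (by omega)
  refine h (isRectangle_of_rowLen (r := j + 1) (w := μ.rowLen 0) (by omega) (by omega) fun i => ?_)
  split_ifs with hi
  · exact hconst i (by omega)
  · have := μ.rowLen_anti (j + 1) i (by omega)
    omega

variable {α β γ μ ν lam : YoungDiagram}

theorem lrCoeff_ne_zero {b c l : ℕ → ℕ} (P : LRPattern b c l) (hα : α.rowLen = b)
    (hβ : β.rowLen = c) (hγ : γ.rowLen = l) : lrCoeff α β γ ≠ 0 := by
  subst hα hβ hγ
  exact Nat.card_ne_zero.2 ⟨⟨P.toTableau⟩, inferInstance⟩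

theorem two_le_lrCoeff {b c l : ℕ → ℕ} (P Q : LRPattern b c l) {i k : ℕ}
    (hne : P.G i k ≠ Q.G i k) (hα : α.rowLen = b) (hβ : β.rowLen = c) (hγ : γ.rowLen = l) :
    2 ≤ lrCoeff α β γ := by
  subst hα hβ hγ
  by_contra! h
  have := Finite.card_le_one_iff_subsingleton.1 (Nat.lt_succ_iff.1 h)
  exact hne (LRPattern.G_eq_of_toTableau_eq (Subsingleton.elim _ _) i k)

theorem two_le_nlNumber_of_two_le {a b g : YoungDiagram} (h1 : lrCoeff a b μ ≠ 0)
    (h2 : lrCoeff a g ν ≠ 0) (h3 : 2 ≤ lrCoeff b g lam) : 2 ≤ nlNumber μ ν lam := by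
  rw [nlNumber, finsum_eq_sum _ (finite_support μ ν lam)]
  have hle : 2 ≤ lrCoeff a b μ * lrCoeff a g ν * lrCoeff b g lam :=
    h3.trans (Nat.le_mul_of_pos_left _ (Nat.pos_of_ne_zero (mul_ne_zero h1 h2)))
  refine hle.trans (single_le_sum (f := fun t : YoungDiagram × YoungDiagram × YoungDiagram =>
    lrCoeff t.1 t.2.1 μ * lrCoeff t.1 t.2.2 ν * lrCoeff t.2.1 t.2.2 lam) (a := (a, b, g))
    (fun _ _ => Nat.zero_le _) ?_)
  rw [Set.Finite.mem_toFinset, Function.mem_support]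
  simp only
  omega

theorem two_le_nlNumber_of_ne {t t' : YoungDiagram × YoungDiagram × YoungDiagram} (hne : t ≠ t')
    (h1 : lrCoeff t.1 t.2.1 μ ≠ 0) (h2 : lrCoeff t.1 t.2.2 ν ≠ 0)
    (h3 : lrCoeff t.2.1 t.2.2 lam ≠ 0) (h1' : lrCoeff t'.1 t'.2.1 μ ≠ 0)
    (h2' : lrCoeff t'.1 t'.2.2 ν ≠ 0) (h3' : lrCoeff t'.2.1 t'.2.2 lam ≠ 0) :
    2 ≤ nlNumber μ ν lam := by
  classical
  rw [nlNumber, finsum_eq_sum _ (finite_support μ ν lam)]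
  have hp := mul_ne_zero (mul_ne_zero h1 h2) h3
  have hp' := mul_ne_zero (mul_ne_zero h1' h2') h3'
  refine le_trans ?_ (sum_le_sum_of_subset (s := {t, t'}) ?_)
  · rw [sum_pair hne]
    omega
  · intro x hx
    rw [Set.Finite.mem_toFinset, Function.mem_support]
    rcases mem_insert.1 hx with rfl | hx
    · exact hp
    · rw [mem_singleton.1 hx]
      exact hp'

/-- Taking the bottom box off one column of γ is allowed with α a box; the other columns `ε` join as
content. -/
theorem lrCoeff_box_ne_zero {m : ℕ} {ε : ℕ → ℕ} (hε : IsShape ε) (hα : α.rowLen = col 1)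
    (hβ : β.rowLen = col m + ε) (hγ : γ.rowLen = col (m + 1) + ε) : lrCoeff α β γ ≠ 0 :=
  lrCoeff_ne_zero ((LRPattern.columnBox m).add (LRPattern.straight hε.1 hε.2))
    (by rw [hα, add_zero]) hβ hγ

theorem isSingleBox_of_rowLen (h : μ.rowLen = col 1) : IsSingleBox μ := by
  refine Finset.ext ?_
  rintro ⟨i, j⟩
  rw [YoungDiagram.mem_cells, YoungDiagram.mem_iff_lt_rowLen, h, col, mem_singleton, Prod.mk.injEq]
  split_ifs <;> omega

theorem rowLen_zero_ne_zero (h : μ ≠ ⊥) : μ.rowLen 0 ≠ 0 := fun h0 => h <| ext_rowLen <| by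
  funext i
  rw [rowLen_bot, Pi.zero_apply]
  exact Nat.le_zero.1 ((μ.rowLen_anti 0 i (Nat.zero_le i)).trans h0.le)

/-- A diagram other than the single box stays nonempty when a corner is removed. -/
theorem col_add_ne_zero {m : ℕ} {ε : ℕ → ℕ} (hε : IsShape ε) (hμ : μ.rowLen = col (m + 1) + ε)
    (h : ¬ IsSingleBox μ) : (col m + ε) 0 ≠ 0 := by
  intro h0
  simp only [Pi.add_apply, col] at h0
  obtain rfl : m = 0 := by
    by_contra hm
    rw [if_pos (by omega)] at h0
    omega
  refine h (isSingleBox_of_rowLen ?_)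
  rw [hμ, zero_add]
  funext i
  have : ε i ≤ ε 0 := hε.1 (Nat.zero_le i)
  simp only [Pi.add_apply]
  omega

/-- Removing a corner from a diagram with at least two boxes, and a column from the rest. -/
theorem exists_remove_corner (h0 : μ ≠ ⊥) (h : ¬ IsSingleBox μ) :
    ∃ m h ε δ, IsShape ε ∧ IsShape δ ∧ μ.rowLen = col (m + 1) + ε ∧
      col m + ε = col (h + 1) + δ := by
  obtain ⟨m, hm, -⟩ := (isShape_rowLen μ).exists_last_corner (rowLen_zero_ne_zero h0)
  obtain ⟨ε, hε, hμ⟩ := (isShape_rowLen μ).exists_eq_col_add hm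
  have hs := (isShape_col m).add hε
  obtain ⟨k, hk, -⟩ := hs.exists_last_corner (col_add_ne_zero hε hμ h)
  obtain ⟨δ, hδ, hδ'⟩ := hs.exists_eq_col_add hk
  exact ⟨m, k, ε, δ, hε, hδ, hμ, hδ'⟩

theorem exists_remove_two_corners (h0 : μ ≠ ⊥) (h : ¬ IsRectangle μ) :
    ∃ i j ε, i < j ∧ IsShape ε ∧ μ.rowLen = col (i + 1) + col (j + 1) + ε := by
  obtain ⟨i, j, hij, hi, hj⟩ := exists_two_corners (rowLen_zero_ne_zero h0) h
  obtain ⟨δ, hδ, hμ⟩ := (isShape_rowLen μ).exists_eq_col_add hi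
  -- The deleted column ends in row `i < j`, so the corner in row `j` is untouched.
  have hj' : δ (j + 1) < δ j := by
    rw [hμ] at hj
    simp only [Pi.add_apply, col] at hj
    rw [if_neg (by omega), if_neg (by omega)] at hj
    omega
  obtain ⟨ε, hε, rfl⟩ := hδ.exists_eq_col_add hj'
  exact ⟨i, j, ε, hij, hε, by rw [hμ, add_assoc]⟩

theorem col_add_col_ne {i j : ℕ} (hij : i < j) (ε : ℕ → ℕ) :
    col i + col (j + 1) + ε ≠ col (i + 1) + col j + ε := fun h => by
  have := congrFun h i
  simp only [Pi.add_apply, col] at this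
  grind

/-- With α a box and β fixed as μ minus a corner, γ is ν minus either of two corners. One column of
β is put below the longer of the two columns of ν, which gives the same λ for both choices; the
remaining columns `δ`, `ρ` are carried along. -/
theorem exists_two_le_of_not_isRectangle_right (hμ0 : μ ≠ ⊥) (hμ : ¬ IsSingleBox μ) (hν0 : ν ≠ ⊥)
    (hν : ¬ IsRectangle ν) : ∃ lam, 2 ≤ nlNumber μ ν lam := by
  obtain ⟨m, h, ε, δ, hε, hδ, hμ', hεδ⟩ := exists_remove_corner hμ0 hμ
  obtain ⟨i, j, ρ, hij, hρ, hν'⟩ := exists_remove_two_corners hν0 hν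
  obtain ⟨a, ha⟩ := (isShape_col 1).exists_rowLen_eq
  obtain ⟨b, hb⟩ := ((isShape_col m).add hε).exists_rowLen_eq
  obtain ⟨g, hg⟩ := (((isShape_col i).add (isShape_col (j + 1))).add hρ).exists_rowLen_eq
  obtain ⟨g', hg'⟩ := (((isShape_col (i + 1)).add (isShape_col j)).add hρ).exists_rowLen_eq
  obtain ⟨lam, hlam⟩ := ((((isShape_col (i + 1)).add (isShape_col (j + (h + 1)))).add hδ).add
    hρ).exists_rowLen_eq
  refine ⟨lam, two_le_nlNumber_of_ne (t := (a, b, g)) (t' := (a, b, g')) ?_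
    (lrCoeff_box_ne_zero hε ha hb hμ') ?_ ?_ (lrCoeff_box_ne_zero hε ha hb hμ') ?_ ?_⟩
  · intro heq
    obtain rfl : g = g' := (Prod.ext_iff.1 (Prod.ext_iff.1 heq).2).2
    exact col_add_col_ne hij ρ (hg.symm.trans hg')
  · exact lrCoeff_box_ne_zero ((isShape_col (j + 1)).add hρ) ha (hg.trans (add_assoc _ _ _))
      (hν'.trans (add_assoc _ _ _))
  · exact lrCoeff_ne_zero (((LRPattern.columnMulShort (h + 1) i j (by omega) hij).add
      (.empty hδ.1)).add (.straight hρ.1 hρ.2)) (by rw [hb, hεδ, add_zero])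
      (by rw [hg, add_zero]) hlam
  · exact lrCoeff_box_ne_zero (m := j) ((isShape_col (i + 1)).add hρ) ha
      (hg'.trans (by rw [add_assoc, add_left_comm])) (hν'.trans (by rw [add_assoc, add_left_comm]))
  · exact lrCoeff_ne_zero (((LRPattern.columnMulLong (h + 1) i j (by omega)).add
      (.empty hδ.1)).add (.straight hρ.1 hρ.2)) (by rw [hb, hεδ, add_zero])
      (by rw [hg', add_zero]) hlam

/-- The mirror image, with the two corners removed from the inner shape β; inner shape and content
play different roles in a pattern, so it needs its own pair of patterns. -/
theorem exists_two_le_of_not_isRectangle_left (hμ0 : μ ≠ ⊥) (hμ : ¬ IsRectangle μ) (hν0 : ν ≠ ⊥)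
    (hν : ¬ IsSingleBox ν) : ∃ lam, 2 ≤ nlNumber μ ν lam := by
  obtain ⟨m, h, ε, δ, hε, hδ, hν', hεδ⟩ := exists_remove_corner hν0 hν
  obtain ⟨i, j, ρ, hij, hρ, hμ'⟩ := exists_remove_two_corners hμ0 hμ
  obtain ⟨a, ha⟩ := (isShape_col 1).exists_rowLen_eq
  obtain ⟨g, hg⟩ := ((isShape_col m).add hε).exists_rowLen_eq
  obtain ⟨b, hb⟩ := (((isShape_col i).add (isShape_col (j + 1))).add hρ).exists_rowLen_eq
  obtain ⟨b', hb'⟩ := (((isShape_col (i + 1)).add (isShape_col j)).add hρ).exists_rowLen_eq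
  obtain ⟨lam, hlam⟩ := ((((isShape_col (i + 1)).add (isShape_col (j + (h + 1)))).add hρ).add
    hδ).exists_rowLen_eq
  refine ⟨lam, two_le_nlNumber_of_ne (t := (a, b, g)) (t' := (a, b', g)) ?_
    ?_ (lrCoeff_box_ne_zero hε ha hg hν') ?_ ?_ (lrCoeff_box_ne_zero hε ha hg hν') ?_⟩
  · intro heq
    obtain rfl : b = b' := (Prod.ext_iff.1 (Prod.ext_iff.1 heq).2).1
    exact col_add_col_ne hij ρ (hb.symm.trans hb')
  · exact lrCoeff_box_ne_zero ((isShape_col (j + 1)).add hρ) ha (hb.trans (add_assoc _ _ _))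
      (hμ'.trans (add_assoc _ _ _))
  · exact lrCoeff_ne_zero (((LRPattern.shortMulColumn (h + 1) i j (by omega) hij).add
      (.empty hρ.1)).add (.straight hδ.1 hδ.2)) (by rw [hb, add_zero])
      (by rw [hg, hεδ, add_zero]) hlam
  · exact lrCoeff_box_ne_zero (m := j) ((isShape_col (i + 1)).add hρ) ha
      (hb'.trans (by rw [add_assoc, add_left_comm])) (hμ'.trans (by rw [add_assoc, add_left_comm]))
  · exact lrCoeff_ne_zero (((LRPattern.longMulColumn (h + 1) i j).add
      (.empty hρ.1)).add (.straight hδ.1 hδ.2)) (by rw [hb', add_zero])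
      (by rw [hg, hεδ, add_zero]) hlam

theorem IsRectangle.isSingleRow_or_isSingleColumn_or (h : IsRectangle μ) :
    IsSingleRow μ ∨ IsSingleColumn μ ∨
      ∃ r ε, 1 ≤ r ∧ IsShape ε ∧ μ.rowLen = col (r + 1) + (col (r + 1) + ε) := by
  obtain ⟨r, w, hr, hw, hc⟩ := id h
  by_cases hr1 : r = 1
  · left
    subst hr1
    exact ⟨w, hw, hc⟩
  by_cases hw1 : w = 1
  · right; left
    subst hw1
    exact ⟨r, hr, hc⟩
  right; right
  have hrow := rowLen_of_cells_eq hc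
  obtain ⟨r, rfl⟩ : ∃ q, r = q + 1 := ⟨r - 1, by omega⟩
  obtain ⟨δ, hδ, hμ⟩ := (isShape_rowLen μ).exists_eq_col_add (m := r)
    (by rw [hrow, hrow, if_neg (by omega), if_pos (by omega)]; omega)
  obtain ⟨ε, hε, rfl⟩ := hδ.exists_eq_col_add (m := r) (by
    have h1 := congrFun hμ r
    have h2 := congrFun hμ (r + 1)
    rw [hrow, Pi.add_apply, col, if_pos (by omega), if_pos (by omega)] at h1
    rw [hrow, Pi.add_apply, col, if_neg (by omega), if_neg (by omega)] at h2
    omega)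
  exact ⟨r, ε, by omega, hε, hμ⟩

/-- Only one triple is used, with a coefficient of at least 2. -/
theorem exists_two_le_of_isRectangle {r s : ℕ} {ε δ : ℕ → ℕ} (hr : 1 ≤ r) (hs : 1 ≤ s)
    (hε : IsShape ε) (hδ : IsShape δ) (hμ : μ.rowLen = col (r + 1) + (col (r + 1) + ε))
    (hν : ν.rowLen = col (s + 1) + (col (s + 1) + δ)) : ∃ lam, 2 ≤ nlNumber μ ν lam := by
  obtain ⟨a, ha⟩ := (isShape_col 1).exists_rowLen_eq
  obtain ⟨b, hb⟩ := ((isShape_col r).add ((isShape_col (r + 1)).add hε)).exists_rowLen_eq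
  obtain ⟨g, hg⟩ := ((isShape_col s).add ((isShape_col (s + 1)).add hδ)).exists_rowLen_eq
  obtain ⟨lam, hlam⟩ := (((((isShape_col (r + s + 1)).add (isShape_col (r + s))).add
    (isShape_col 1)).add hε).add hδ).exists_rowLen_eq
  refine ⟨lam, two_le_nlNumber_of_two_le
    (lrCoeff_box_ne_zero ((isShape_col (r + 1)).add hε) ha hb hμ)
    (lrCoeff_box_ne_zero ((isShape_col (s + 1)).add hδ) ha hg hν)
    (two_le_lrCoeff
      (((LRPattern.twoColumns₁ r s hr hs).add (.empty hε.1)).add (.straight hδ.1 hδ.2))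
      (((LRPattern.twoColumns₂ r s hr hs).add (.empty hε.1)).add (.straight hδ.1 hδ.2))
      -- In row `r` the first cell added to the shorter column is 1 in one tableau and 2 in the
      -- other; the common summands `ε`, `δ` cancel.
      (i := r) (k := 1) ?_ (by rw [hb, add_zero, add_assoc]) (by rw [hg, add_zero, add_assoc])
      hlam)⟩
  simp only [LRPattern.add, LRPattern.twoColumns₁, LRPattern.twoColumns₂, segG, ne_eq,
    add_left_inj]
  grind

theorem cases_of_isNLMultiplicityFree (h : IsNLMultiplicityFree μ ν) :
    (μ = ⊥ ∨ IsSingleBox μ ∨ ν = ⊥ ∨ IsSingleBox ν) ∨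
      ((IsSingleRow μ ∧ IsRectangle ν) ∨ (IsSingleRow ν ∧ IsRectangle μ)) ∨
      ((IsSingleColumn μ ∧ IsRectangle ν) ∨ (IsSingleColumn ν ∧ IsRectangle μ)) := by
  have hfree : ¬ ∃ lam, 2 ≤ nlNumber μ ν lam := fun ⟨lam, hlam⟩ => by
    rcases h lam with h | h <;> omega
  by_contra hne
  simp only [not_or] at hne
  obtain ⟨⟨hμ0, hμ1, hν0, hν1⟩, ⟨hr1, hr2⟩, hc1, hc2⟩ := hne
  by_cases hμ : IsRectangle μ
  · by_cases hν : IsRectangle ν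
    · rcases hμ.isSingleRow_or_isSingleColumn_or with h1 | h1 | ⟨r, ε, hr, hε, h1⟩
      · exact hr1 ⟨h1, hν⟩
      · exact hc1 ⟨h1, hν⟩
      rcases hν.isSingleRow_or_isSingleColumn_or with h2 | h2 | ⟨s, δ, hs, hδ, h2⟩
      · exact hr2 ⟨h2, hμ⟩
      · exact hc2 ⟨h2, hμ⟩
      exact hfree (exists_two_le_of_isRectangle hr hs hε hδ h1 h2)
    · exact hfree (exists_two_le_of_not_isRectangle_right hμ0 hμ1 hν0 hν)
  · exact hfree (exists_two_le_of_not_isRectangle_left hμ0 hμ hν0 hν1)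

end

end NewellLittlewood

theorem theorem6p1 (mu nu : YoungDiagram) :
    IsNLMultiplicityFree mu nu ↔
      ((mu = ⊥ ∨ IsSingleBox mu ∨ nu = ⊥ ∨ IsSingleBox nu) ∨
        ((IsSingleRow mu ∧ IsRectangle nu) ∨ (IsSingleRow nu ∧ IsRectangle mu)) ∨
        ((IsSingleColumn mu ∧ IsRectangle nu) ∨ (IsSingleColumn nu ∧ IsRectangle mu))) := by
  exact ⟨cases_of_isNLMultiplicityFree, isNLMultiplicityFree_of_cases⟩
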